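/- Let $r,s\ge 0$ be integers and $n=r+s$. Let $\Lambda_X\in\mathbb{R}^{r\times r}$ be a diagonal matrix with positive diagonal entries and $\Lambda_S\in\mathbb{R}^{s\times s}$ a diagonal matrix with negative diagonal entries, and set $$Z=\begin{pmatrix}\Lambda_X&0\\0&\Lambda_S\end{pmatrix},\qquad X=\begin{pmatrix}\Lambda_X&0\\0&0\end{pmatrix},\qquad S=\begin{pmatrix}0&0\\0&-\Lambda_S\end{pmatrix}.$$ Let $\Pi$ be the orthogonal projection (with respect to the Frobenius norm) of the real symmetric $n\times n$ matrices onto the cone of positive semidefinite matrices. For a real symmetric $n\times n$ matrix $H$ put $$X'=\Pi(Z+H),\qquad S'=X'-(Z+H),\qquad \Delta X=X'-X,\qquad \Delta S=S'-S .$$ Let $\alpha=\{1,\dots,r\}$ and $\gamma=\{r+1,\dots,n\}$, and let $A_{\gamma\alpha}$ etc. denote the corresponding blocks of an $n\times n$ matrix $A$. Let $\|\cdot\|$ denote arbitrary norms on $\mathbb{R}^{n\times n}$, $\mathbb{R}^{r\times r}$, $\mathbb{R}^{s\times r}$ and $\mathbb{R}^{s\times s}$. Then there are constants $\delta>0$ and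 $C>0$, depending only on $\Lambda_X$, $\Lambda_S$ and the norms, such that for every real symmetric $H$ with $\|H\|\le\delta$: $$\|X'_{\alpha\alpha}-\Lambda_X\|\le C\|\Delta X\|,\qquad \|S'_{\gamma\gamma}-(-\Lambda_S)\|\le C\|\Delta S\|,$$ $$\|X'_{\gamma\alpha}\|\le C\min\{\|\Delta X\|,\|\Delta S\|\},\qquad \|S'_{\gamma\alpha}\|\le C\min\{\|\Delta X\|,\|\Delta S\|\},$$ $$\|X'_{\gamma\gamma}\|\le C\|\Delta X\|\,\|\Delta S\|,\qquad \|S'_{\alpha\alpha}\|\le C\|\Delta X\|\,\|\Delta S\|,$$ $$\|S'_{\gamma\alpha}\Lambda_X-\Lambda_S X'_{\gamma\alpha}\|\le C\|\Delta X\|\,\|\Delta S\| .$$ -/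

import Mathlib

namespace PSDPerturb

open Matrix

/-- A seminorm on a space of real matrices is a norm when it vanishes only at `0`. -/
def IsMatrixNorm {m n : Type*} (p : Seminorm ℝ (Matrix m n ℝ)) : Prop :=
  ∀ A : Matrix m n ℝ, p A = 0 → A = 0

section

open scoped Matrix.Norms.Frobenius

/-- `X` is a nearest point to `A`, in the Frobenius norm, in the cone of symmetric positive
semidefinite matrices. -/
def IsPSDProj {n : Type*} [Fintype n] (A X : Matrix n n ℝ) : Prop :=
  X.PosSemidef ∧ ∀ Y : Matrix n n ℝ, Y.PosSemidef → ‖A - X‖ ≤ ‖A - Y‖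

theorem isClosed_posSemidef {n : Type*} [Fintype n] :
    IsClosed {X : Matrix n n ℝ | X.PosSemidef} := by
  classical
  have h : {X : Matrix n n ℝ | X.PosSemidef} =
      {X | Xᴴ = X} ∩ ⋂ v : n → ℝ, {X | 0 ≤ star v ⬝ᵥ (X *ᵥ v)} := by
    ext X
    simp only [Set.mem_ofPred_eq, Set.mem_inter_iff, Set.mem_iInter]
    exact Matrix.posSemidef_iff_dotProduct_mulVec
  rw [h]
  refine (isClosed_eq (by fun_prop) continuous_id).inter (isClosed_iInter fun v => ?_)
  exact isClosed_le continuous_const (by fun_prop)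

theorem exists_isPSDProj {n : Type*} [Fintype n] (A : Matrix n n ℝ) :
    ∃ X : Matrix n n ℝ, IsPSDProj A X := by
  have : ProperSpace (Matrix n n ℝ) := FiniteDimensional.proper_real _
  obtain ⟨X, hX, h⟩ := (isClosed_posSemidef (n := n)).exists_infDist_eq_dist
    ⟨0, Matrix.PosSemidef.zero⟩ A
  refine ⟨X, hX, fun Y hY => ?_⟩
  rw [← dist_eq_norm, ← dist_eq_norm, ← h]
  exact Metric.infDist_le_dist_of_mem hY

theorem frobenius_sq {n : Type*} [Fintype n] (A : Matrix n n ℝ) :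
    ‖A‖ ^ 2 = ∑ i, ∑ j, A i j ^ 2 := by
  have h : 0 ≤ ∑ i, ∑ j, A i j ^ 2 :=
    Finset.sum_nonneg fun i _ => Finset.sum_nonneg fun j _ => sq_nonneg _
  rw [Matrix.frobenius_norm_def, ← Real.sqrt_eq_rpow]
  simp only [Real.rpow_two, Real.norm_eq_abs, sq_abs]
  exact Real.sq_sqrt h

theorem IsPSDProj.unique {n : Type*} [Fintype n] {A X Y : Matrix n n ℝ}
    (hX : IsPSDProj A X) (hY : IsPSDProj A Y) : X = Y := by
  have hM : ((1 / 2 : ℝ) • (X + Y)).PosSemidef := (hX.1.add hY.1).smul (by norm_num)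
  have hXY : ‖A - X‖ = ‖A - Y‖ := le_antisymm (hX.2 Y hY.1) (hY.2 X hX.1)
  have hle := pow_le_pow_left₀ (norm_nonneg _) (hX.2 _ hM) 2
  have key : ‖A - (1 / 2 : ℝ) • (X + Y)‖ ^ 2 =
      (1 / 2) * ‖A - X‖ ^ 2 + (1 / 2) * ‖A - Y‖ ^ 2 - (1 / 4) * ‖X - Y‖ ^ 2 := by
    simp only [frobenius_sq, Finset.mul_sum, ← Finset.sum_add_distrib, ← Finset.sum_sub_distrib]
    refine Finset.sum_congr rfl fun i _ => Finset.sum_congr rfl fun j _ => ?_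
    simp only [Matrix.sub_apply, Matrix.smul_apply, Matrix.add_apply, smul_eq_mul]
    ring
  rw [key, ← hXY] at hle
  have h0 : ‖X - Y‖ ^ 2 ≤ 0 := by linarith
  have h1 : ‖X - Y‖ = 0 := by
    have := sq_nonneg ‖X - Y‖
    exact pow_eq_zero_iff (two_ne_zero) |>.1 (le_antisymm h0 this)
  exact sub_eq_zero.1 (norm_eq_zero.1 h1)

end

/-- The orthogonal projection (with respect to the Frobenius norm) onto the cone of symmetric
positive semidefinite matrices. -/
noncomputable def psdProj {n : Type*} [Fintype n] (A : Matrix n n ℝ) : Matrix n n ℝ :=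
  (exists_isPSDProj A).choose

theorem isPSDProj_psdProj {n : Type*} [Fintype n] (A : Matrix n n ℝ) :
    IsPSDProj A (psdProj A) :=
  (exists_isPSDProj A).choose_spec

end PSDPerturb

/-! Optimality of the projection makes `X'` and `S'` positive semidefinite with `X' * S' = 0`
(`IsPSDProj.posSemidef_sub`, `IsPSDProj.mul_sub_eq_zero`). Such splittings are nonexpansive: `‖ΔX‖²
+ ‖ΔS‖² ≤ ‖H‖²` in the Frobenius norm (`frobenius_norm_sq_add_sq_le`). So for small `H` the blocks
`X'_αα` and `S'_γγ` stay near `Λ_X` and `-Λ_S` and remain uniformly invertible.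

The bounds then come from reading `X' * S' = 0` blockwise (`frobenius_block_bounds`). The
off-diagonal equation makes `X'_γα` and `S'_γα` comparable, so each is controlled by either
increment. The diagonal equations express `X'_γγ` and `S'_αα` through products of the two
off-diagonal blocks, hence the quadratic bounds. Equivalence of norms passes from Frobenius to
arbitrary norms. -/

namespace PSDPerturb

open Matrix

/-! ### Equivalence of norms in finite dimension. -/

section NormEquivalence

variable {E : Type*} [NormedAddCommGroup E] [NormedSpace ℝ E] [FiniteDimensional ℝ E]

theorem seminorm_continuous (p : Seminorm ℝ E) : Continuous p := by
  have h := p.convexOn.continuousOn isOpen_univ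
  exact continuousOn_univ.1 h

theorem exists_seminorm_le_mul_norm (p : Seminorm ℝ E) :
    ∃ K : ℝ, 0 < K ∧ ∀ x, p x ≤ K * ‖x‖ :=
  Seminorm.bound_of_continuous_normedSpace p (seminorm_continuous p)

theorem exists_norm_le_mul_seminorm (p : Seminorm ℝ E) (hp : ∀ x, p x = 0 → x = 0) :
    ∃ K : ℝ, 0 < K ∧ ∀ x, ‖x‖ ≤ K * p x := by
  have : ProperSpace E := FiniteDimensional.proper_real E
  rcases (Metric.sphere (0 : E) 1).eq_empty_or_nonempty with h | h
  -- The unit sphere is empty only when `E` is trivial.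
  · refine ⟨1, one_pos, fun x => ?_⟩
    have hx : x = 0 := by
      by_contra hx
      have : ‖x‖⁻¹ • x ∈ Metric.sphere (0 : E) 1 := by
        simp [norm_smul, norm_ne_zero_iff.2 hx]
      simp [h] at this
    simp [hx]
  · obtain ⟨u, hu, hmin⟩ := (isCompact_sphere (0 : E) 1).exists_isMinOn h
      (seminorm_continuous p).continuousOn
    have hu0 : u ≠ 0 := by
      rintro rfl
      simp at hu
    have hpu : 0 < p u := lt_of_le_of_ne (apply_nonneg p u) fun h0 => hu0 (hp u h0.symm)
    refine ⟨(p u)⁻¹, inv_pos.2 hpu, fun x => ?_⟩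
    rcases eq_or_ne x 0 with rfl | hx
    · simp
    have hxn : 0 < ‖x‖ := norm_pos_iff.2 hx
    have hmem : ‖x‖⁻¹ • x ∈ Metric.sphere (0 : E) 1 := by
      simp [norm_smul, hxn.ne']
    have hle : p u ≤ p (‖x‖⁻¹ • x) := hmin hmem
    rw [map_smul_eq_mul, norm_inv, norm_norm, ← div_eq_inv_mul, le_div_iff₀ hxn] at hle
    rwa [← div_eq_inv_mul, le_div_iff₀ hpu, mul_comm]

end NormEquivalence

/-! ### Trace pairing of positive semidefinite matrices. -/

section Trace

variable {n : Type*} [Fintype n]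

open scoped MatrixOrder Matrix.Norms.L2Operator in
theorem exists_eq_conjTranspose_mul_self {A : Matrix n n ℝ} (hA : A.PosSemidef) :
    ∃ C : Matrix n n ℝ, A = Cᴴ * C := by
  classical
  exact CStarAlgebra.nonneg_iff_eq_star_mul_self.1 hA.nonneg

theorem trace_mul_nonneg {A B : Matrix n n ℝ} (hA : A.PosSemidef) (hB : B.PosSemidef) :
    0 ≤ (A * B).trace := by
  classical
  obtain ⟨C, rfl⟩ := exists_eq_conjTranspose_mul_self hA
  rw [Matrix.mul_assoc, Matrix.trace_mul_comm]
  exact (hB.mul_mul_conjTranspose_same C).trace_nonneg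

/-- With `A = Cᴴ * C` and `B = Dᴴ * D`, the trace is the squared Frobenius norm of `D * Cᴴ`. Its
vanishing kills the middle factor of `Cᴴ * (C * Dᴴ) * D`. -/
theorem mul_eq_zero_of_trace_mul_eq_zero {A B : Matrix n n ℝ} (hA : A.PosSemidef)
    (hB : B.PosSemidef) (h : (A * B).trace = 0) : A * B = 0 := by
  classical
  obtain ⟨C, rfl⟩ := exists_eq_conjTranspose_mul_self hA
  rw [Matrix.mul_assoc, Matrix.trace_mul_comm,
    (hB.mul_mul_conjTranspose_same C).trace_eq_zero_iff] at h
  obtain ⟨D, rfl⟩ := exists_eq_conjTranspose_mul_self hB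
  have h' : (D * Cᴴ)ᴴ * (D * Cᴴ) = 0 := by
    rw [conjTranspose_mul, conjTranspose_conjTranspose, ← h]
    simp only [Matrix.mul_assoc]
  rw [Matrix.conjTranspose_mul_self_eq_zero] at h'
  have h2 : C * Dᴴ = 0 := by
    simpa [conjTranspose_mul] using congrArg conjTranspose h'
  rw [Matrix.mul_assoc, ← Matrix.mul_assoc C, h2]
  simp

end Trace

/-! ### Frobenius estimates, optimality of the projection, and block bounds. -/

section Frobenius

open scoped Matrix.Norms.Frobenius

variable {m n : Type*} [Fintype m] [Fintype n]

theorem frobenius_norm_sq (A : Matrix m n ℝ) : ‖A‖ ^ 2 = ∑ i, ∑ j, A i j ^ 2 := by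
  have h : 0 ≤ ∑ i, ∑ j, A i j ^ 2 :=
    Finset.sum_nonneg fun i _ => Finset.sum_nonneg fun j _ => sq_nonneg _
  rw [Matrix.frobenius_norm_def, ← Real.sqrt_eq_rpow]
  simp only [Real.rpow_two, Real.norm_eq_abs, sq_abs]
  exact Real.sq_sqrt h

theorem frobenius_norm_blocks_sq {k l : Type*} [Fintype k] [Fintype l]
    (A : Matrix (m ⊕ k) (n ⊕ l) ℝ) :
    ‖A‖ ^ 2 = ‖A.toBlocks₁₁‖ ^ 2 + ‖A.toBlocks₁₂‖ ^ 2 + ‖A.toBlocks₂₁‖ ^ 2 +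
      ‖A.toBlocks₂₂‖ ^ 2 := by
  simp only [frobenius_norm_sq, Fintype.sum_sum_type, Finset.sum_add_distrib, toBlocks₁₁,
    toBlocks₁₂, toBlocks₂₁, toBlocks₂₂, of_apply]
  ring

theorem mul_frobenius_norm_le_diagonal_mul [DecidableEq m] {c : ℝ} (hc : 0 ≤ c) {d : m → ℝ}
    (hd : ∀ i, c ≤ |d i|) (A : Matrix m n ℝ) : c * ‖A‖ ≤ ‖Matrix.diagonal d * A‖ := by
  refine le_of_sq_le_sq ?_ (norm_nonneg _)
  rw [mul_pow, frobenius_norm_sq, frobenius_norm_sq, Finset.mul_sum]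
  refine Finset.sum_le_sum fun i _ => ?_
  rw [Finset.mul_sum]
  refine Finset.sum_le_sum fun j _ => ?_
  rw [Matrix.diagonal_mul, mul_pow, ← sq_abs (d i)]
  have := hd i
  gcongr

/-- Quantitative invertibility without inverses: the perturbation costs at most half of the lower
bound `c`. -/
theorem mul_frobenius_norm_le_mul [DecidableEq m] {c : ℝ} (hc : 0 ≤ c) {d : m → ℝ}
    (hd : ∀ i, c ≤ |d i|) {B : Matrix m m ℝ} (hB : ‖B - Matrix.diagonal d‖ ≤ c / 2)
    (A : Matrix m n ℝ) : c / 2 * ‖A‖ ≤ ‖B * A‖ := by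
  have h1 := mul_frobenius_norm_le_diagonal_mul hc hd A
  have h2 : Matrix.diagonal d * A = B * A - (B - Matrix.diagonal d) * A := by
    rw [Matrix.sub_mul]; abel
  have h3 : ‖(B - Matrix.diagonal d) * A‖ ≤ c / 2 * ‖A‖ :=
    (Matrix.frobenius_norm_mul _ _).trans (mul_le_mul_of_nonneg_right hB (norm_nonneg _))
  have h4 := norm_sub_le (B * A) ((B - Matrix.diagonal d) * A)
  rw [← h2] at h4
  linarith

theorem frobenius_norm_add_smul_sq {A : Matrix n n ℝ} (hA : A.IsSymm) (B : Matrix n n ℝ) (t : ℝ) :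
    ‖A + t • B‖ ^ 2 = ‖A‖ ^ 2 + 2 * t * (A * B).trace + t ^ 2 * ‖B‖ ^ 2 := by
  have h : (A * B).trace = ∑ i, ∑ j, A i j * B i j := by
    rw [Finset.sum_comm]
    simp only [Matrix.trace, Matrix.diag_apply, Matrix.mul_apply]
    exact Finset.sum_congr rfl fun i _ => Finset.sum_congr rfl fun j _ => by rw [hA.apply j i]
  simp only [frobenius_norm_sq, h, Finset.mul_sum, ← Finset.sum_add_distrib]
  refine Finset.sum_congr rfl fun i _ => Finset.sum_congr rfl fun j _ => ?_
  simp only [Matrix.add_apply, Matrix.smul_apply, smul_eq_mul]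
  ring

theorem nonneg_of_forall_quadratic_nonneg {a b : ℝ}
    (h : ∀ t : ℝ, 0 < t → t ≤ 1 → 0 ≤ 2 * t * a + t ^ 2 * b) : 0 ≤ a := by
  by_contra! ha
  have hb : 0 < |b| + 1 := by positivity
  -- This `t` is small enough that `t * b ≤ -a`, so `2 * a + t * b ≤ a < 0`.
  have hpos : 0 < min 1 (-a / (|b| + 1)) := lt_min one_pos (div_pos (by linarith) hb)
  have h1 := h _ hpos (min_le_left _ _)
  have h2 : min 1 (-a / (|b| + 1)) * (|b| + 1) ≤ -a :=
    (le_div_iff₀ hb).1 (min_le_right _ _)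
  set t := min 1 (-a / (|b| + 1))
  have h3 : 0 ≤ t * (2 * a + t * b) := by linarith
  have h4 := nonneg_of_mul_nonneg_right h3 hpos
  have h5 : t * b ≤ t * (|b| + 1) :=
    mul_le_mul_of_nonneg_left (by linarith [le_abs_self b]) hpos.le
  linarith

theorem IsPSDProj.isSymm_sub {A X : Matrix n n ℝ} (hA : A.IsSymm) (h : IsPSDProj A X) :
    (X - A).IsSymm := by
  have hX : X.IsSymm := by simpa [Matrix.IsHermitian, Matrix.IsSymm] using h.1.isHermitian
  exact hX.sub hA

/-- First-order optimality: the trace is half the derivative at `t = 0` of `‖X + t • Y - A‖²`. -/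
theorem IsPSDProj.trace_nonneg_of_feasible {A X Y : Matrix n n ℝ} (hA : A.IsSymm)
    (h : IsPSDProj A X) (hY : ∀ t : ℝ, 0 < t → t ≤ 1 → (X + t • Y).PosSemidef) :
    0 ≤ ((X - A) * Y).trace := by
  refine nonneg_of_forall_quadratic_nonneg (b := ‖Y‖ ^ 2) fun t ht ht1 => ?_
  have h1 := pow_le_pow_left₀ (norm_nonneg _) (h.2 _ (hY t ht ht1)) 2
  rw [norm_sub_rev A X, norm_sub_rev A, add_sub_right_comm,
    frobenius_norm_add_smul_sq (h.isSymm_sub hA)] at h1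
  linarith

theorem IsPSDProj.posSemidef_sub {A X : Matrix n n ℝ} (hA : A.IsSymm) (h : IsPSDProj A X) :
    (X - A).PosSemidef := by
  refine Matrix.posSemidef_iff_dotProduct_mulVec.2
    ⟨by simpa [Matrix.IsHermitian, Matrix.IsSymm] using h.isSymm_sub hA, fun v => ?_⟩
  -- Adding a rank-one matrix is always feasible and tests the quadratic form at `v`.
  have h1 := h.trace_nonneg_of_feasible hA (Y := Matrix.vecMulVec v (star v)) fun t ht _ =>
    h.1.add ((Matrix.posSemidef_vecMulVec_self_star v).smul ht.le)
  rwa [Matrix.mul_vecMulVec, Matrix.trace_vecMulVec, dotProduct_comm] at h1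

theorem IsPSDProj.mul_sub_eq_zero {A X : Matrix n n ℝ} (hA : A.IsSymm) (h : IsPSDProj A X) :
    X * (X - A) = 0 := by
  refine mul_eq_zero_of_trace_mul_eq_zero h.1 (h.posSemidef_sub hA) (le_antisymm ?_ ?_)
  -- Shrinking `X` towards `0` stays in the cone and gives the reverse trace inequality.
  · have h1 := h.trace_nonneg_of_feasible hA (Y := -X) fun t _ ht1 => by
      have : X + t • -X = (1 - t) • X := by rw [sub_smul, one_smul, smul_neg, sub_eq_add_neg]
      rw [this]
      exact h.1.smul (sub_nonneg.2 ht1)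
    rw [Matrix.mul_neg, Matrix.trace_neg, Matrix.trace_mul_comm] at h1
    linarith
  · exact trace_mul_nonneg h.1 (h.posSemidef_sub hA)

/-- The decomposition of a symmetric matrix into complementary positive semidefinite parts is
nonexpansive in the Frobenius norm. -/
theorem frobenius_norm_sq_add_sq_le {X S X' S' : Matrix n n ℝ} (hX : X.PosSemidef)
    (hS : S.PosSemidef) (hX' : X'.PosSemidef) (hS' : S'.PosSemidef) (h : X * S = 0)
    (h' : X' * S' = 0) :
    ‖X' - X‖ ^ 2 + ‖S' - S‖ ^ 2 ≤ ‖(X' - X) - (S' - S)‖ ^ 2 := by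
  have hsymm : (X' - X).IsSymm := by
    simpa [Matrix.IsHermitian, Matrix.IsSymm] using hX'.isHermitian.sub hX.isHermitian
  have h1 := frobenius_norm_add_smul_sq hsymm (S' - S) (-1)
  have h2 := trace_mul_nonneg hX hS'
  have h3 := trace_mul_nonneg hX' hS
  -- Complementarity removes two of the four terms; the other two make the cross term favourable.
  have h4 : ((X' - X) * (S' - S)).trace = -(X * S').trace - (X' * S).trace := by
    rw [Matrix.sub_mul, Matrix.mul_sub, Matrix.mul_sub, h, h']
    simp only [Matrix.trace_sub, Matrix.trace_zero]
    ring
  rw [h4, neg_one_smul, ← sub_eq_add_neg] at h1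
  linarith

theorem frobenius_norm_toBlocks_le {k l : Type*} [Fintype k] [Fintype l]
    (A : Matrix (m ⊕ k) (n ⊕ l) ℝ) :
    ‖A.toBlocks₁₁‖ ≤ ‖A‖ ∧ ‖A.toBlocks₂₁‖ ≤ ‖A‖ ∧ ‖A.toBlocks₂₂‖ ≤ ‖A‖ := by
  have h := frobenius_norm_blocks_sq A
  refine ⟨?_, ?_, ?_⟩ <;> refine le_of_sq_le_sq ?_ (norm_nonneg _) <;> rw [h] <;>
    linarith [sq_nonneg ‖A.toBlocks₁₁‖, sq_nonneg ‖A.toBlocks₁₂‖, sq_nonneg ‖A.toBlocks₂₁‖,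
      sq_nonneg ‖A.toBlocks₂₂‖]

/-- Block perturbation bounds for complementary symmetric matrices, in the Frobenius norm. -/
theorem frobenius_block_bounds [DecidableEq m] [DecidableEq n] {d : m → ℝ} {e : n → ℝ} {c T : ℝ}
    (hc : 0 < c) (hd : ∀ i, c ≤ d i) (he : ∀ i, e i ≤ -c)
    (hdT : ‖Matrix.diagonal d‖ + c / 2 ≤ T) (heT : ‖Matrix.diagonal e‖ + c / 2 ≤ T)
    {A P : Matrix m m ℝ} {B Q : Matrix n m ℝ} {D R : Matrix n n ℝ} {x y : ℝ}
    (hD : D.IsSymm) (hR : R.IsSymm) (hA : A.IsSymm)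
    (hxc : x ≤ c / 2) (hyc : y ≤ c / 2)
    (hAx : ‖A - Matrix.diagonal d‖ ≤ x) (hBx : ‖B‖ ≤ x) (hQy : ‖Q‖ ≤ y)
    (hRy : ‖R + Matrix.diagonal e‖ ≤ y)
    (h11 : A * P + Bᵀ * Q = 0) (h12 : A * Qᵀ + Bᵀ * R = 0) (h22 : B * Qᵀ + D * R = 0) :
    ‖B‖ ≤ 2 * T / c * y ∧ ‖Q‖ ≤ 2 * T / c * x ∧ ‖D‖ ≤ 2 / c * (x * y) ∧
      ‖P‖ ≤ 2 / c * (x * y) ∧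
      ‖Q * Matrix.diagonal d - Matrix.diagonal e * B‖ ≤ 2 * (x * y) := by
  -- In the application `A, B, D` are the αα, γα, γγ blocks of `X'`, `P, Q, R` those of `S'`, and
  -- `x, y` are `‖ΔX‖, ‖ΔS‖`.
  have hx : 0 ≤ x := (norm_nonneg _).trans hBx
  have hy : 0 ≤ y := (norm_nonneg _).trans hQy
  have hd' : ∀ i, c ≤ |d i| := fun i => (hd i).trans (le_abs_self _)
  have he' : ∀ i, c ≤ |(-e) i| := fun i =>
    le_trans (by rw [Pi.neg_apply]; linarith [he i]) (le_abs_self _)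
  have hneg : Matrix.diagonal (-e) = -Matrix.diagonal e := (Matrix.diagonal_neg e).symm
  have hR' : ‖R - Matrix.diagonal (-e)‖ ≤ y := by rwa [hneg, sub_neg_eq_add]
  have hAT : ‖A‖ ≤ T := by
    have := norm_add_le (A - Matrix.diagonal d) (Matrix.diagonal d)
    rw [sub_add_cancel] at this
    linarith
  have hRT : ‖R‖ ≤ T := by
    have := norm_sub_le (R + Matrix.diagonal e) (Matrix.diagonal e)
    rw [add_sub_cancel_right] at this
    linarith
  have hAc := hAx.trans hxc
  have hRc := hR'.trans hyc
  have h21 : Q * A + R * B = 0 := by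
    have := congrArg Matrix.transpose h12
    simpa [Matrix.transpose_mul, hA.eq, hR.eq] using this
  have h22' : Q * Bᵀ + R * D = 0 := by
    have := congrArg Matrix.transpose h22
    simpa [Matrix.transpose_mul, hD.eq, hR.eq] using this
  have key : ∀ {a b : ℝ}, c / 2 * a ≤ b → a ≤ 2 / c * b := fun {a b} h => by
    rw [div_mul_eq_mul_div, le_div_iff₀ hc]
    linarith
  have hQB : ‖Q‖ * ‖B‖ ≤ x * y := by
    rw [mul_comm x y]
    exact mul_le_mul hQy hBx (norm_nonneg _) hy
  refine ⟨?_, ?_, ?_, ?_, ?_⟩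
  · have h1 := mul_frobenius_norm_le_mul hc.le he' hRc B
    rw [eq_neg_of_add_eq_zero_right h21, norm_neg] at h1
    have h2 : ‖Q * A‖ ≤ y * T :=
      (Matrix.frobenius_norm_mul _ _).trans (mul_le_mul hQy hAT (norm_nonneg _) hy)
    refine (key (h1.trans h2)).trans_eq ?_
    ring
  · have h1 := mul_frobenius_norm_le_mul hc.le hd' hAc Qᵀ
    rw [eq_neg_of_add_eq_zero_left h12, norm_neg, Matrix.frobenius_norm_transpose] at h1
    have h2 : ‖Bᵀ * R‖ ≤ x * T := by
      refine (Matrix.frobenius_norm_mul _ _).trans ?_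
      rw [Matrix.frobenius_norm_transpose]
      exact mul_le_mul hBx hRT (norm_nonneg _) hx
    refine (key (h1.trans h2)).trans_eq ?_
    ring
  · have h1 := mul_frobenius_norm_le_mul hc.le he' hRc D
    rw [eq_neg_of_add_eq_zero_right h22', norm_neg] at h1
    have h2 := Matrix.frobenius_norm_mul Q Bᵀ
    rw [Matrix.frobenius_norm_transpose] at h2
    exact key (h1.trans (h2.trans hQB))
  · have h1 := mul_frobenius_norm_le_mul hc.le hd' hAc P
    rw [eq_neg_of_add_eq_zero_left h11, norm_neg] at h1
    have h2 := Matrix.frobenius_norm_mul Bᵀ Q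
    rw [Matrix.frobenius_norm_transpose, mul_comm] at h2
    exact key (h1.trans (h2.trans hQB))
  · have h1 : Q * Matrix.diagonal d - Matrix.diagonal e * B =
        -- Subtracting `Q * A + R * B = 0` leaves only products of two small factors.
        -(Q * (A - Matrix.diagonal d)) - (R + Matrix.diagonal e) * B := by
      rw [Matrix.mul_sub, Matrix.add_mul, eq_neg_of_add_eq_zero_left h21]
      abel
    rw [h1]
    have h2 : ‖Q * (A - Matrix.diagonal d)‖ ≤ y * x :=
      (Matrix.frobenius_norm_mul _ _).trans (mul_le_mul hQy hAx (norm_nonneg _) hy)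
    have h3 : ‖(R + Matrix.diagonal e) * B‖ ≤ y * x :=
      (Matrix.frobenius_norm_mul _ _).trans (mul_le_mul hRy hBx (norm_nonneg _) hy)
    have h4 := norm_sub_le (-(Q * (A - Matrix.diagonal d))) ((R + Matrix.diagonal e) * B)
    rw [norm_neg] at h4
    linarith

theorem exists_pos_forall_le {ι : Type*} [Finite ι] (f : ι → ℝ) (hf : ∀ i, 0 < f i) :
    ∃ c : ℝ, 0 < c ∧ ∀ i, c ≤ f i := by
  rcases isEmpty_or_nonempty ι with h | h
  · exact ⟨1, one_pos, fun i => isEmptyElim i⟩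
  · obtain ⟨i, hi⟩ := Finite.exists_min f
    exact ⟨f i, hf i, hi⟩

/-- The block perturbation bounds for the positive semidefinite projection, in the Frobenius
norm. -/
theorem exists_frobenius_psdProj_bounds [DecidableEq m] [DecidableEq n] (d : m → ℝ) (e : n → ℝ)
    (hd : ∀ i, 0 < d i) (he : ∀ i, e i < 0) :
    ∃ ε : ℝ, 0 < ε ∧ ∃ K : ℝ, 1 ≤ K ∧ ∀ H : Matrix (m ⊕ n) (m ⊕ n) ℝ, H.IsSymm → ‖H‖ ≤ ε →
      ∀ X' S' ΔX ΔS : Matrix (m ⊕ n) (m ⊕ n) ℝ,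
        X' = psdProj (fromBlocks (diagonal d) 0 0 (diagonal e) + H) →
        S' = X' - (fromBlocks (diagonal d) 0 0 (diagonal e) + H) →
        ΔX = X' - fromBlocks (diagonal d) 0 0 0 →
        ΔS = S' - fromBlocks 0 0 0 (-diagonal e) →
        ‖X'.toBlocks₁₁ - diagonal d‖ ≤ K * ‖ΔX‖ ∧
        ‖S'.toBlocks₂₂ - (-diagonal e)‖ ≤ K * ‖ΔS‖ ∧
        ‖X'.toBlocks₂₁‖ ≤ K * min ‖ΔX‖ ‖ΔS‖ ∧
        ‖S'.toBlocks₂₁‖ ≤ K * min ‖ΔX‖ ‖ΔS‖ ∧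
        ‖X'.toBlocks₂₂‖ ≤ K * (‖ΔX‖ * ‖ΔS‖) ∧
        ‖S'.toBlocks₁₁‖ ≤ K * (‖ΔX‖ * ‖ΔS‖) ∧
        ‖S'.toBlocks₂₁ * diagonal d - diagonal e * X'.toBlocks₂₁‖ ≤ K * (‖ΔX‖ * ‖ΔS‖) := by
  obtain ⟨c₁, hc₁, hdc⟩ := exists_pos_forall_le d hd
  obtain ⟨c₂, hc₂, hec⟩ := exists_pos_forall_le (-e) fun i => neg_pos.2 (he i)
  obtain ⟨c, hc, hcc₁, hcc₂⟩ : ∃ c : ℝ, 0 < c ∧ c ≤ c₁ ∧ c ≤ c₂ :=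
    ⟨min c₁ c₂, lt_min hc₁ hc₂, min_le_left _ _, min_le_right _ _⟩
  obtain ⟨T, hT⟩ : ∃ T : ℝ, T = ‖diagonal d‖ + ‖diagonal e‖ + c / 2 := ⟨_, rfl⟩
  have hdn := norm_nonneg (diagonal d)
  have hen := norm_nonneg (diagonal e)
  have hT0 : 0 < T := by linarith
  have hTc : 0 < 2 * T / c := by positivity
  have h2c : 0 < 2 / c := by positivity
  -- The radius keeps both increments below `c / 2`; the sum dominates every constant needed: `1`,
  -- `2`, `2 * T / c` and `2 / c`.
  refine ⟨c / 2, by positivity, 2 + 2 * T / c + 2 / c, by linarith, ?_⟩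
  intro H hH hHε X' S' ΔX ΔS hX' hS' hΔX hΔS
  have hZ : (fromBlocks (diagonal d) 0 0 (diagonal e) + H).IsSymm :=
    ((isSymm_diagonal d).fromBlocks Matrix.transpose_zero (isSymm_diagonal e)).add hH
  have hproj := isPSDProj_psdProj (fromBlocks (diagonal d) 0 0 (diagonal e) + H)
  rw [← hX'] at hproj
  have hXpsd := hproj.1
  have hSpsd := hproj.posSemidef_sub hZ
  have hmul := hproj.mul_sub_eq_zero hZ
  rw [← hS'] at hSpsd hmul
  have hX0 : (fromBlocks (diagonal d) 0 0 (0 : Matrix n n ℝ)).PosSemidef := by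
    have : fromBlocks (diagonal d) 0 0 (0 : Matrix n n ℝ) = diagonal (Sum.elim d 0) := by
      rw [← Matrix.fromBlocks_diagonal, Matrix.diagonal_zero']
    rw [this]
    refine Matrix.PosSemidef.diagonal fun i => ?_
    rcases i with i | i
    · exact (hd i).le
    · exact le_rfl
  have hS0 : (fromBlocks (0 : Matrix m m ℝ) 0 0 (-diagonal e)).PosSemidef := by
    have : fromBlocks (0 : Matrix m m ℝ) 0 0 (-diagonal e) = diagonal (Sum.elim 0 (-e)) := by
      rw [← Matrix.fromBlocks_diagonal, Matrix.diagonal_zero', Matrix.diagonal_neg e]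
      rfl
    rw [this]
    refine Matrix.PosSemidef.diagonal fun i => ?_
    rcases i with i | i
    · exact le_rfl
    · exact (neg_pos.2 (he i)).le
  have hXS0 : fromBlocks (diagonal d) 0 0 (0 : Matrix n n ℝ) *
      fromBlocks (0 : Matrix m m ℝ) 0 0 (-diagonal e) = 0 := by
    simp [Matrix.fromBlocks_multiply]
  have hnonexp := frobenius_norm_sq_add_sq_le hX0 hS0 hXpsd hSpsd hXS0 hmul
  have hdiff : ΔX - ΔS = H := by
    have hsplit : fromBlocks (diagonal d) 0 0 (diagonal e) =
        fromBlocks (diagonal d) 0 0 (0 : Matrix n n ℝ) -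
          fromBlocks (0 : Matrix m m ℝ) 0 0 (-diagonal e) := by
      rw [sub_eq_add_neg, Matrix.fromBlocks_neg, Matrix.fromBlocks_add]
      simp
    rw [hΔX, hΔS, hS', hsplit]
    abel
  rw [← hΔX, ← hΔS, hdiff] at hnonexp
  have hx : ‖ΔX‖ ≤ c / 2 := by
    refine le_trans (le_of_sq_le_sq ?_ (norm_nonneg _)) hHε
    linarith [sq_nonneg ‖ΔS‖]
  have hy : ‖ΔS‖ ≤ c / 2 := by
    refine le_trans (le_of_sq_le_sq ?_ (norm_nonneg _)) hHε
    linarith [sq_nonneg ‖ΔX‖]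
  have hXsymm : X'ᵀ = X' := by simpa [Matrix.IsHermitian] using hXpsd.isHermitian
  have hSsymm : S'ᵀ = S' := by simpa [Matrix.IsHermitian] using hSpsd.isHermitian
  obtain ⟨hX1, hX2, -⟩ := frobenius_norm_toBlocks_le ΔX
  obtain ⟨-, hS2, hS3⟩ := frobenius_norm_toBlocks_le ΔS
  have eX1 : ΔX.toBlocks₁₁ = X'.toBlocks₁₁ - diagonal d := by rw [hΔX]; rfl
  have eX2 : ΔX.toBlocks₂₁ = X'.toBlocks₂₁ := by
    rw [hΔX]; ext i j; simp [toBlocks₂₁]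
  have eS2 : ΔS.toBlocks₂₁ = S'.toBlocks₂₁ := by
    rw [hΔS]; ext i j; simp [toBlocks₂₁]
  have eS3 : ΔS.toBlocks₂₂ = S'.toBlocks₂₂ + diagonal e := by
    rw [← sub_neg_eq_add, hΔS]; rfl
  rw [eX1] at hX1
  rw [eX2] at hX2
  rw [eS2] at hS2
  rw [eS3] at hS3
  have hX12 : X'.toBlocks₁₂ = X'.toBlocks₂₁ᵀ := by
    ext i j; exact congrFun (congrFun hXsymm.symm (Sum.inl i)) (Sum.inr j)
  have hS12 : S'.toBlocks₁₂ = S'.toBlocks₂₁ᵀ := by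
    ext i j; exact congrFun (congrFun hSsymm.symm (Sum.inl i)) (Sum.inr j)
  have hXA : X'.toBlocks₁₁.IsSymm := by
    ext i j; exact congrFun (congrFun hXsymm (Sum.inl i)) (Sum.inl j)
  have hXD : X'.toBlocks₂₂.IsSymm := by
    ext i j; exact congrFun (congrFun hXsymm (Sum.inr i)) (Sum.inr j)
  have hSR : S'.toBlocks₂₂.IsSymm := by
    ext i j; exact congrFun (congrFun hSsymm (Sum.inr i)) (Sum.inr j)
  rw [← Matrix.fromBlocks_toBlocks X', ← Matrix.fromBlocks_toBlocks S', hX12, hS12,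
    Matrix.fromBlocks_multiply, ← Matrix.fromBlocks_zero, Matrix.fromBlocks_inj] at hmul
  obtain ⟨h11, h12, -, h22⟩ := hmul
  obtain ⟨b1, b2, b3, b4, b5⟩ := frobenius_block_bounds hc (fun i => hcc₁.trans (hdc i))
    (fun i => by have := hec i; rw [Pi.neg_apply] at this; linarith)
    (T := T) (by linarith) (by linarith) hXD hSR hXA hx hy hX1 hX2 hS2 hS3 h11 h12 h22
  have hxn := norm_nonneg ΔX
  have hyn := norm_nonneg ΔS
  have hxy := mul_nonneg hxn hyn
  have mono : ∀ {a b k : ℝ}, 0 ≤ b → k ≤ 2 + 2 * T / c + 2 / c → a ≤ k * b →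
      a ≤ (2 + 2 * T / c + 2 / c) * b := fun hb hk h => h.trans (mul_le_mul_of_nonneg_right hk hb)
  have one_mono : ∀ {a b : ℝ}, 0 ≤ b → a ≤ b → a ≤ (2 + 2 * T / c + 2 / c) * b := fun hb h =>
    mono hb (k := 1) (by linarith) (by rwa [one_mul])
  refine ⟨one_mono hxn hX1, ?_, ?_, ?_, mono hxy (by linarith) b3, mono hxy (by linarith) b4,
    mono hxy (by linarith) b5⟩
  · rw [sub_neg_eq_add]
    exact one_mono hyn hS3
  · rcases min_choice ‖ΔX‖ ‖ΔS‖ with h | h <;> rw [h]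
    · exact one_mono hxn hX2
    · exact mono hyn (by linarith) b1
  · rcases min_choice ‖ΔX‖ ‖ΔS‖ with h | h <;> rw [h]
    · exact mono hxn (by linarith) b2
    · exact one_mono hyn hS2

theorem IsMatrixNorm.exists_norm_le {p : Seminorm ℝ (Matrix m n ℝ)} (hp : IsMatrixNorm p) :
    ∃ K : ℝ, 0 < K ∧ ∀ A : Matrix m n ℝ, ‖A‖ ≤ K * p A :=
  exists_norm_le_mul_seminorm p hp

theorem exists_seminorm_le_frobenius (p : Seminorm ℝ (Matrix m n ℝ)) :
    ∃ K : ℝ, 0 < K ∧ ∀ A : Matrix m n ℝ, p A ≤ K * ‖A‖ :=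
  exists_seminorm_le_mul_norm p

end Frobenius

end PSDPerturb

open scoped Matrix.Norms.Frobenius in
theorem mainTheorem8 (r s : ℕ) (lamX : Fin r → ℝ) (lamS : Fin s → ℝ)
    (hlamX : ∀ i, 0 < lamX i) (hlamS : ∀ i, lamS i < 0)
    (N : Seminorm ℝ (Matrix (Fin r ⊕ Fin s) (Fin r ⊕ Fin s) ℝ))
    (Nαα : Seminorm ℝ (Matrix (Fin r) (Fin r) ℝ))
    (Nγα : Seminorm ℝ (Matrix (Fin s) (Fin r) ℝ))
    (Nγγ : Seminorm ℝ (Matrix (Fin s) (Fin s) ℝ))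
    (hN : PSDPerturb.IsMatrixNorm N) (hNαα : PSDPerturb.IsMatrixNorm Nαα)
    (hNγα : PSDPerturb.IsMatrixNorm Nγα) (hNγγ : PSDPerturb.IsMatrixNorm Nγγ) :
    let ΛX : Matrix (Fin r) (Fin r) ℝ := Matrix.diagonal lamX
    let ΛS : Matrix (Fin s) (Fin s) ℝ := Matrix.diagonal lamS
    let Z : Matrix (Fin r ⊕ Fin s) (Fin r ⊕ Fin s) ℝ := Matrix.fromBlocks ΛX 0 0 ΛS
    let X : Matrix (Fin r ⊕ Fin s) (Fin r ⊕ Fin s) ℝ := Matrix.fromBlocks ΛX 0 0 0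
    let S : Matrix (Fin r ⊕ Fin s) (Fin r ⊕ Fin s) ℝ := Matrix.fromBlocks 0 0 0 (-ΛS)
    ∃ δ : ℝ, 0 < δ ∧ ∃ C : ℝ, 0 < C ∧
      ∀ H : Matrix (Fin r ⊕ Fin s) (Fin r ⊕ Fin s) ℝ, H.IsSymm → N H ≤ δ →
        let X' := PSDPerturb.psdProj (Z + H)
        let S' := X' - (Z + H)
        let ΔX := X' - X
        let ΔS := S' - S
        Nαα (X'.toBlocks₁₁ - ΛX) ≤ C * N ΔX ∧
        Nγγ (S'.toBlocks₂₂ - (-ΛS)) ≤ C * N ΔS ∧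
        Nγα X'.toBlocks₂₁ ≤ C * min (N ΔX) (N ΔS) ∧
        Nγα S'.toBlocks₂₁ ≤ C * min (N ΔX) (N ΔS) ∧
        Nγγ X'.toBlocks₂₂ ≤ C * (N ΔX * N ΔS) ∧
        Nαα S'.toBlocks₁₁ ≤ C * (N ΔX * N ΔS) ∧
        Nγα (S'.toBlocks₂₁ * ΛX - ΛS * X'.toBlocks₂₁) ≤ C * (N ΔX * N ΔS) := by
  intro ΛX ΛS Z X S
  obtain ⟨ε, hε, K, hK, hmain⟩ := PSDPerturb.exists_frobenius_psdProj_bounds lamX lamS hlamX hlamS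
  obtain ⟨L, hL, hNL⟩ := hN.exists_norm_le
  obtain ⟨K₁, hK₁, h₁⟩ := PSDPerturb.exists_seminorm_le_frobenius Nαα
  obtain ⟨K₂, hK₂, h₂⟩ := PSDPerturb.exists_seminorm_le_frobenius Nγα
  obtain ⟨K₃, hK₃, h₃⟩ := PSDPerturb.exists_seminorm_le_frobenius Nγγ
  have hK0 : 0 < K := one_pos.trans_le hK
  obtain ⟨M, hM⟩ : ∃ M : ℝ, M = (K₁ + K₂ + K₃) * K := ⟨_, rfl⟩
  have hM0 : 0 < M := by rw [hM]; positivity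
  have hM₁ : K₁ * K ≤ M := by rw [hM]; gcongr; linarith
  have hM₂ : K₂ * K ≤ M := by rw [hM]; gcongr; linarith
  have hM₃ : K₃ * K ≤ M := by rw [hM]; gcongr; linarith
  -- `L` converts the linear and minimum bounds to `N`, `L * L` the product bounds; their sum serves
  -- both.
  refine ⟨ε / L, by positivity, M * (L + L * L), by positivity, ?_⟩
  intro H hH hNH X' S' ΔX ΔS
  have hHε : ‖H‖ ≤ ε := (hNL H).trans (by rwa [le_div_iff₀' hL] at hNH)
  obtain ⟨b1, b2, b3, b4, b5, b6, b7⟩ := hmain H hH hHε X' S' ΔX ΔS rfl rfl rfl rfl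
  have step : ∀ {a f u v k k' : ℝ}, 0 ≤ v → 0 ≤ k → k * K ≤ M → k' ≤ L + L * L →
      a ≤ k * f → f ≤ K * u → u ≤ k' * v → a ≤ M * (L + L * L) * v := by
    intro a f u v k k' hv hk hkM hk' haf hfu huv
    calc a ≤ k * (K * ((L + L * L) * v)) :=
          haf.trans (by
            gcongr
            exact hfu.trans (by
              gcongr
              exact huv.trans (mul_le_mul_of_nonneg_right hk' hv)))
      _ = k * K * ((L + L * L) * v) := by ring
      _ ≤ M * ((L + L * L) * v) := by gcongr
      _ = M * (L + L * L) * v := by ring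
  have hx := hNL ΔX
  have hy := hNL ΔS
  have hx0 : 0 ≤ N ΔX := apply_nonneg N ΔX
  have hy0 : 0 ≤ N ΔS := apply_nonneg N ΔS
  have hLL : L ≤ L + L * L := by linarith [mul_pos hL hL]
  have hLL' : L * L ≤ L + L * L := by linarith
  have hmin : min ‖ΔX‖ ‖ΔS‖ ≤ L * min (N ΔX) (N ΔS) := by
    rw [mul_min_of_nonneg _ _ hL.le]
    exact min_le_min hx hy
  have hprod : ‖ΔX‖ * ‖ΔS‖ ≤ L * L * (N ΔX * N ΔS) :=
    (mul_le_mul hx hy (norm_nonneg _) (by positivity)).trans_eq (by ring)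
  have hmin0 : 0 ≤ min (N ΔX) (N ΔS) := le_min hx0 hy0
  have hprod0 : 0 ≤ N ΔX * N ΔS := mul_nonneg hx0 hy0
  exact ⟨step hx0 hK₁.le hM₁ hLL (h₁ _) b1 hx, step hy0 hK₃.le hM₃ hLL (h₃ _) b2 hy,
    step hmin0 hK₂.le hM₂ hLL (h₂ _) b3 hmin, step hmin0 hK₂.le hM₂ hLL (h₂ _) b4 hmin,
    step hprod0 hK₃.le hM₃ hLL' (h₃ _) b5 hprod, step hprod0 hK₁.le hM₁ hLL' (h₁ _) b6 hprod,
    step hprod0 hK₂.le hM₂ hLL' (h₂ _) b7 hprod⟩
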